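/- Let $\mathcal X$ be a measurable space, $\mathcal Y=\{1,\dots,K\}$, let $\tilde D$ (the distribution of the noisy data) be any probability distribution on $\mathcal X\times\mathcal Y$, and let $\mathcal H$ be a set of measurable classifiers $h:\mathcal X\to\mathcal Y$. A finite set $S\subset\mathcal X$ is shattered by $\mathcal H$ if all binary labelings of $S$ are realized by $\mathcal H$. For $K=2$ this means that every map $S\to\mathcal Y$ is the restriction of some $h\in\mathcal H$; for general $K$ it means that there is a reference labeling $f:\mathcal X\to\mathcal Y$ such that for every $T\subseteq S$ some $h\in\mathcal H$ agrees with $f$ on $T$ and disagrees with $f$ at every point of $S\setminus T$ (for $K=2$ the two formulations are equivalent). The VC dimension $d_{VC}$ of $\mathcal H$ is the largest cardinality of a shattered set; assume that it is finite. Assume the usual measurability condition on $\mathcal H$: for all $n$ and all $T\subseteq\{1,\dots,n\}$, the set of samples $(x_i,y_i)_{i\le n}$ for which some $h\in\mathcal H$ satisfies $h(x_i)=y_i$ exactly for $i\in T$ is measurable for the completion of $\tilde D^{n}$ (this holds, for instance, whenever $\mathcal H$ is countable). Let $\tilde S=\{(x_i,\tilde y_i)\}_{i=1}^m$ be drawn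 i.i.d. from $\tilde D$, where $m\ge 1$ and $2m\ge d_{VC}$, and put $$A_{\tilde D}(h)=\Pr_{(X,\tilde Y)\sim\tilde D}[h(X)=\tilde Y],\qquad A_{\tilde S}(h)=\frac1m\sum_{i=1}^m \mathbf 1(h(x_i)=\tilde y_i).$$ Then for every $\delta>0$, with probability at least $1-\delta$ over the draw of $\tilde S$, simultaneously for all $h\in\mathcal H$, $$A_{\tilde D}(h)-A_{\tilde S}(h)\ \ge\ -\sqrt{\frac{8\left(d_{VC}\left(\ln(2m/d_{VC})+1\right)+\ln(4/\delta)\right)}{m}},$$ where $d_{VC}(\ln(2m/d_{VC})+1)$ is read as $0$ if $d_{VC}=0$. -/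

import Mathlib

open MeasureTheory

/-- `Shatters H S`: all binary labelings of the finite set `S` of features are realized by the
classifiers in `H`. A classifier `h` labels `x` in a binary way by agreeing or disagreeing with a
reference labeling `f`. For two classes this is the usual notion, that every labeling of `S` by
the two labels is the restriction of some `h ∈ H` (`shatters_two_iff` below). For any number of
classes it is shattering by the 0-1 losses `(x, y) ↦ 1(h x = y)`. -/
def Shatters {X : Type*} {K : ℕ} (H : Set (X → Fin K)) (S : Finset X) : Prop :=
  ∃ f : X → Fin K, ∀ T ⊆ S, ∃ h ∈ H, ∀ x ∈ S, (h x = f x ↔ x ∈ T)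

/-- In the binary case, `Shatters` says that every labeling of `S` is realized by `H`. -/
theorem shatters_two_iff {X : Type*} (H : Set (X → Fin 2)) (S : Finset X) :
    Shatters H S ↔ ∀ c : X → Fin 2, ∃ h ∈ H, ∀ x ∈ S, h x = c x := by
  classical
  constructor
  · rintro ⟨f, hf⟩ c
    obtain ⟨h, hH, hh⟩ := hf (S.filter fun x => c x = f x) (Finset.filter_subset _ _)
    refine ⟨h, hH, fun x hx => ?_⟩
    have := hh x hx
    simp only [Finset.mem_filter, hx, true_and] at this
    omega
  · intro hc
    refine ⟨fun _ => 1, fun T _ => ?_⟩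
    obtain ⟨h, hH, hh⟩ := hc fun x => if x ∈ T then 1 else 0
    refine ⟨h, hH, fun x hx => ?_⟩
    rw [hh x hx]
    by_cases hT : x ∈ T <;> simp [hT]

/-- The VC dimension of `H`: the largest cardinality of a shattered set of features, `⊤` if there
are arbitrarily large ones. -/
noncomputable def vcDim {X : Type*} {K : ℕ} (H : Set (X → Fin K)) : ℕ∞ :=
  ⨆ S : {S : Finset X // Shatters H S}, (S.1.card : ℕ∞)

/-- The accuracy of `h` on a distribution `D` of (feature, label) pairs: `Pr[h(X) = Y]`. -/
noncomputable def accuracy {X : Type*} [MeasurableSpace X] {K : ℕ}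
    (D : Measure (X × Fin K)) (h : X → Fin K) : ℝ :=
  D.real {z | h z.1 = z.2}

/-- The accuracy of `h` on a sample `S` of size `m`: the fraction of correctly labeled points. -/
noncomputable def sampleAccuracy {X : Type*} {K m : ℕ}
    (S : Fin m → X × Fin K) (h : X → Fin K) : ℝ :=
  (1 / (m : ℝ)) * ∑ i, if h (S i).1 = (S i).2 then (1 : ℝ) else 0

/-- The usual measurability convention for uniform laws over a possibly uncountable class `H`:
for each sample size `n` and each pattern `T` of correctly classified positions, the event that
some `h ∈ H` is correct on an i.i.d. sample exactly at the positions in `T` is measurable with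
respect to the completion of the law of the sample. -/
def MeasurableClass {X : Type*} [MeasurableSpace X] {K : ℕ}
    (D : Measure (X × Fin K)) (H : Set (X → Fin K)) : Prop :=
  ∀ (n : ℕ) (T : Finset (Fin n)),
    NullMeasurableSet
      {S : Fin n → X × Fin K | ∃ h ∈ H, ∀ i, (h (S i).1 = (S i).2 ↔ i ∈ T)}
      (Measure.pi fun _ => D)

/-! This is the Vapnik-Chervonenkis double-sample argument. If some `h` is far too accurate on the
sample, then with probability at least 1/2 the same `h` is not too accurate on an independent ghost
sample, so its scores on the two halves differ (`measure_exists_deviation_le`). Swapping the halves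
at any positions preserves the law of the double sample, so its points can be frozen and only the
swaps randomized (`measure_deviationSet_le`). Then `h` matters only through its correctness pattern:
Sauer-Shelah bounds the number of patterns (`card_correctPatterns_le`), Hoeffding bounds the bad
swaps for each (`card_signs_le`), and a union bound combines them. Working with patterns instead of
labelings removes `K` from the bound. -/

/-- Hoeffding's inequality for Rademacher sums, in counting form. -/
theorem card_signs_le {ι : Type*} [Fintype ι] [DecidableEq ι] [Nonempty ι] (u : ι → ℝ)
    (hu : ∀ i, |u i| ≤ 1) {t : ℝ} (ht : 0 ≤ t) :
    ((Finset.univ.filter fun σ : ι → Bool => t ≤ ∑ i, if σ i then -u i else u i).card : ℝ) ≤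
      2 ^ Fintype.card ι * Real.exp (-t ^ 2 / (2 * Fintype.card ι)) := by
  set n : ℝ := (Fintype.card ι : ℝ) with hn
  have hn0 : 0 < n := by rw [hn]; exact_mod_cast Fintype.card_pos
  -- This is the minimizer of the Chernoff exponent `n * l ^ 2 / 2 - l * t`.
  set l : ℝ := t / n with hl
  have hl0 : 0 ≤ l := by positivity
  have hmgf : ∑ σ : ι → Bool, Real.exp (l * ∑ i, if σ i then -u i else u i) ≤
      2 ^ Fintype.card ι * Real.exp (n * (l ^ 2 / 2)) := by
    have heq : ∑ σ : ι → Bool, Real.exp (l * ∑ i, if σ i then -u i else u i) =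
        ∏ i, ∑ b : Bool, Real.exp (l * if b then -u i else u i) := by
      rw [Finset.prod_univ_sum, Fintype.piFinset_univ]
      exact Finset.sum_congr rfl fun σ _ => by rw [Finset.mul_sum, Real.exp_sum]
    rw [heq]
    calc _ ≤ ∏ _i : ι, 2 * Real.exp (l ^ 2 / 2) := by
          refine Finset.prod_le_prod (fun i _ => by positivity) fun i _ => ?_
          have h1 := Real.cosh_le_exp_half_sq (l * u i)
          rw [Real.cosh_eq] at h1
          have h2 : Real.exp ((l * u i) ^ 2 / 2) ≤ Real.exp (l ^ 2 / 2) := by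
            refine Real.exp_le_exp.2 (div_le_div_of_nonneg_right ?_ zero_le_two)
            rw [mul_pow]
            exact mul_le_of_le_one_right (sq_nonneg l) ((sq_le_one_iff_abs_le_one _).2 (hu i))
          simp only [Fintype.sum_bool, if_true, Bool.false_eq_true, if_false, mul_neg]
          linarith
      _ = _ := by
          rw [Finset.prod_const, Finset.card_univ, mul_pow, ← Real.exp_nat_mul]
  have hmarkov : ((Finset.univ.filter fun σ : ι → Bool =>
      t ≤ ∑ i, if σ i then -u i else u i).card : ℝ) * Real.exp (l * t) ≤
      ∑ σ : ι → Bool, Real.exp (l * ∑ i, if σ i then -u i else u i) := by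
    rw [← nsmul_eq_mul]
    refine (Finset.card_nsmul_le_sum _ (fun σ : ι → Bool =>
      Real.exp (l * ∑ i, if σ i then -u i else u i)) _ fun σ hσ => ?_).trans
      (Finset.sum_le_sum_of_subset_of_nonneg (Finset.filter_subset _ _)
        fun _ _ _ => (Real.exp_pos _).le)
    have := (Finset.mem_filter.1 hσ).2
    gcongr
  have hexp : Real.exp (n * (l ^ 2 / 2)) =
      Real.exp (-t ^ 2 / (2 * n)) * Real.exp (l * t) := by
    rw [← Real.exp_add]
    congr 1
    rw [hl]
    field_simp
    ring
  have := hmarkov.trans hmgf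
  rw [hexp, ← mul_assoc] at this
  exact le_of_mul_le_mul_right this (Real.exp_pos _)

/-- The usual bound `∑ k ≤ d, C(n, k) ≤ (e n / d) ^ d` on partial sums of binomial coefficients. -/
theorem sum_choose_le {n d : ℕ} (hdn : d ≤ n) :
    ((∑ k ∈ Finset.Iic d, n.choose k : ℕ) : ℝ) ≤
      Real.exp ((d : ℝ) * (Real.log ((n : ℝ) / d) + 1)) := by
  rcases Nat.eq_zero_or_pos d with rfl | hd
  · have : Finset.Iic 0 = ({0} : Finset ℕ) := rfl
    simp [this]
  have hd0 : (0 : ℝ) < d := by exact_mod_cast hd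
  have hn0 : (0 : ℝ) < n := by exact_mod_cast hd.trans_le hdn
  -- As `x ≤ 1`, `x ^ d ≤ x ^ k` for `k ≤ d`, so the sum times `x ^ d` is at most `(1 + x) ^ n ≤ exp
  -- d`.
  set x : ℝ := d / n with hx
  have hx0 : 0 < x := by positivity
  have hx1 : x ≤ 1 := (div_le_one hn0).2 (by exact_mod_cast hdn)
  have h1 : ((∑ k ∈ Finset.Iic d, n.choose k : ℕ) : ℝ) * x ^ d ≤ Real.exp d := by
    calc _ = ∑ k ∈ Finset.Iic d, (n.choose k : ℝ) * x ^ d := by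
          rw [Nat.cast_sum, Finset.sum_mul]
      _ ≤ ∑ k ∈ Finset.Iic d, x ^ k * 1 ^ (n - k) * (n.choose k : ℝ) := by
          refine Finset.sum_le_sum fun k hk => ?_
          rw [one_pow, mul_one, mul_comm]
          gcongr ?_ * _
          exact pow_le_pow_of_le_one hx0.le hx1 (Finset.mem_Iic.1 hk)
      _ ≤ ∑ k ∈ Finset.range (n + 1), x ^ k * 1 ^ (n - k) * (n.choose k : ℝ) := by
          refine Finset.sum_le_sum_of_subset_of_nonneg (fun k hk => ?_)
            fun _ _ _ => by positivity
          have := Finset.mem_Iic.1 hk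
          exact Finset.mem_range.2 (by omega)
      _ = (x + 1) ^ n := (add_pow x 1 n).symm
      _ ≤ Real.exp x ^ n := by
          gcongr
          exact Real.add_one_le_exp x
      _ = Real.exp d := by
          rw [← Real.exp_nat_mul, hx, mul_div_cancel₀ _ hn0.ne']
  have h2 : Real.exp ((d : ℝ) * (Real.log ((n : ℝ) / d) + 1)) * x ^ d = Real.exp d := by
    rw [← Real.exp_log hx0, ← Real.exp_nat_mul, ← Real.exp_add, hx,
      Real.log_div hn0.ne' hd0.ne', Real.log_div hd0.ne' hn0.ne']
    congr 1
    ring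
  exact le_of_mul_le_mul_right (h1.trans h2.ge) (by positivity)

/-! ### Correctness patterns and the Sauer-Shelah bound. -/

/-- The finite sets of positions at which some `h ∈ H` classifies the sample `S` correctly. -/
noncomputable def correctPatterns {X ι : Type*} [Fintype ι] {K : ℕ} (H : Set (X → Fin K))
    (S : ι → X × Fin K) : Finset (Finset ι) := by
  classical
  exact Finset.univ.filter fun T => ∃ h ∈ H, ∀ i, h (S i).1 = (S i).2 ↔ i ∈ T

theorem mem_correctPatterns {X ι : Type*} [Fintype ι] {K : ℕ} {H : Set (X → Fin K)}
    {S : ι → X × Fin K} {T : Finset ι} :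
    T ∈ correctPatterns H S ↔ ∃ h ∈ H, ∀ i, h (S i).1 = (S i).2 ↔ i ∈ T := by
  classical
  simp [correctPatterns]

/-- Positions shattered by the correctness patterns carry distinct features, which are shattered
by `H` itself. -/
theorem card_le_of_shatters_correctPatterns {X ι : Type*} [Fintype ι] [DecidableEq ι] {K : ℕ}
    {H : Set (X → Fin K)} {d : ℕ} (hd : vcDim H = d) (S : ι → X × Fin K) {I : Finset ι}
    (hI : (correctPatterns H S).Shatters I) : I.card ≤ d := by
  classical
  have key : ∀ T ⊆ I, ∃ h ∈ H, ∀ i ∈ I, h (S i).1 = (S i).2 ↔ i ∈ T := by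
    intro T hT
    obtain ⟨U, hU, rfl⟩ := hI hT
    obtain ⟨h, hH, hh⟩ := mem_correctPatterns.1 hU
    exact ⟨h, hH, fun i hi => by simp [hh, hi]⟩
  -- Two positions with one feature that can both be correct have equal labels, so no classifier is
  -- correct at just one of them.
  have hinj : Set.InjOn (fun i => (S i).1) (I : Set ι) := by
    intro i hi j hj hij
    simp only [Finset.mem_coe] at hi hj hij
    by_contra hne
    obtain ⟨h, -, hh⟩ := key I subset_rfl
    have hlab : (S i).2 = (S j).2 := by
      rw [← (hh i hi).2 hi, ← (hh j hj).2 hj, hij]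
    obtain ⟨g, -, hg⟩ := key {i} (by simpa using hi)
    have h1 := (hg i hi).2 (by simp)
    have h2 := (hg j hj).1 (by rw [← hij, h1, hlab])
    exact hne (Finset.mem_singleton.1 h2).symm
  rw [← Finset.card_image_of_injOn hinj]
  have hsh : Shatters H (I.image fun i => (S i).1) := by
    rcases I.eq_empty_or_nonempty with rfl | ⟨i₀, hi₀⟩
    · obtain ⟨h, hH, -⟩ := key ∅ subset_rfl
      exact ⟨h, fun T _ => ⟨h, hH, by simp⟩⟩
    -- The reference labeling reads the labels off the sample; its value outside the features of `I`
    -- is immaterial.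
    · refine ⟨fun x => if hx : ∃ i ∈ I, (S i).1 = x then (S hx.choose).2 else (S i₀).2,
        fun T _ => ?_⟩
      obtain ⟨h, hH, hh⟩ := key (I.filter fun i => (S i).1 ∈ T) (Finset.filter_subset _ _)
      refine ⟨h, hH, fun x hx => ?_⟩
      obtain ⟨i, hi, rfl⟩ := Finset.mem_image.1 hx
      have hex : ∃ j ∈ I, (S j).1 = (S i).1 := ⟨i, hi, rfl⟩
      have hch : hex.choose = i := hinj hex.choose_spec.1 hi hex.choose_spec.2
      simp only [dif_pos hex, hch]
      rw [hh i hi]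
      simp [hi]
  have hle := le_iSup (fun S : {S : Finset X // Shatters H S} => (S.1.card : ℕ∞)) ⟨_, hsh⟩
  change _ ≤ vcDim H at hle
  rw [hd] at hle
  exact_mod_cast hle

/-- The Sauer-Shelah bound on the number of correctness patterns. -/
theorem card_correctPatterns_le {X ι : Type*} [Fintype ι] {K : ℕ}
    {H : Set (X → Fin K)} {d : ℕ} (hd : vcDim H = d) (hdn : d ≤ Fintype.card ι)
    (S : ι → X × Fin K) :
    ((correctPatterns H S).card : ℝ) ≤
      Real.exp ((d : ℝ) * (Real.log ((Fintype.card ι : ℝ) / d) + 1)) := by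
  classical
  refine le_trans ?_ (sum_choose_le hdn)
  have hvc : (correctPatterns H S).vcDim ≤ d := Finset.sup_le fun I hI =>
    card_le_of_shatters_correctPatterns hd S (Finset.mem_shatterer.1 hI)
  exact_mod_cast ((Finset.card_le_card_shatterer _).trans
    Finset.card_shatterer_le_sum_vcDim).trans
    (Finset.sum_le_sum_of_subset (Finset.Iic_subset_Iic.2 hvc))

/-! ### Measurability and symmetry of the double sample. -/

/-- Reindexing an i.i.d. sample preserves its law. -/
theorem measurePreserving_comp_equiv {Z ι κ : Type*} [MeasurableSpace Z] [Fintype ι] [Fintype κ]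
    (D : Measure Z) [SigmaFinite D] (e : ι ≃ κ) :
    MeasurePreserving (fun S : κ → Z => S ∘ e) (Measure.pi fun _ => D)
      (Measure.pi fun _ => D) := by
  have h := measurePreserving_piCongrLeft (α := fun _ : ι => Z) (fun _ => D) e.symm
  convert h using 1
  ext S i
  have := MeasurableEquiv.piCongrLeft_apply_apply (β := fun _ : ι => Z) e.symm S (e i)
  simpa using this.symm

/-- Transports the hypothesis from `Fin n` to any finite index type; it is needed for `ι ⊕ ι`. -/
theorem MeasurableClass.nullMeasurableSet {X ι : Type*} [MeasurableSpace X] [Fintype ι] {K : ℕ}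
    {D : Measure (X × Fin K)} [SigmaFinite D] {H : Set (X → Fin K)} (hH : MeasurableClass D H)
    (T : Finset ι) :
    NullMeasurableSet {S : ι → X × Fin K | T ∈ correctPatterns H S} (Measure.pi fun _ => D) := by
  have e := Fintype.equivFin ι
  have h := (hH _ (T.map e.toEmbedding)).preimage
    (measurePreserving_comp_equiv D e.symm).quasiMeasurePreserving
  convert h using 1
  ext S
  simp only [Set.mem_ofPred_eq, mem_correctPatterns, Set.mem_preimage, Function.comp_apply,
    Finset.mem_map_equiv]
  exact exists_congr fun h => and_congr_right fun _ =>
    e.forall_congr_left (p := fun i => h (S i).1 = (S i).2 ↔ i ∈ T)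

/-- The double samples on which some `h ∈ H` is correct at least `t` times more often on the first
half than on the second half. -/
def deviationSet {X ι : Type*} [Fintype ι] {K : ℕ} (H : Set (X → Fin K)) (t : ℝ) :
    Set (ι ⊕ ι → X × Fin K) :=
  {S | ∃ h ∈ H, t ≤ ∑ i, ((if h (S (.inl i)).1 = (S (.inl i)).2 then (1 : ℝ) else 0) -
    if h (S (.inr i)).1 = (S (.inr i)).2 then 1 else 0)}

theorem mem_deviationSet_iff {X ι : Type*} [Fintype ι] [DecidableEq ι] {K : ℕ}
    {H : Set (X → Fin K)} {t : ℝ} {S : ι ⊕ ι → X × Fin K} :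
    S ∈ deviationSet H t ↔ ∃ T ∈ correctPatterns H S,
      t ≤ ∑ i, ((if .inl i ∈ T then (1 : ℝ) else 0) - if .inr i ∈ T then 1 else 0) := by
  constructor
  · rintro ⟨h, hH, ht⟩
    exact ⟨Finset.univ.filter fun i => h (S i).1 = (S i).2,
      mem_correctPatterns.2 ⟨h, hH, by simp⟩, by simpa using ht⟩
  · rintro ⟨T, hT, ht⟩
    obtain ⟨h, hH, hh⟩ := mem_correctPatterns.1 hT
    exact ⟨h, hH, by simpa only [hh] using ht⟩

/-- The deviation depends on `h` only through its pattern, so the event is a finite union of pattern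
events. -/
theorem MeasurableClass.nullMeasurableSet_deviationSet {X ι : Type*} [MeasurableSpace X]
    [Fintype ι] {K : ℕ} {D : Measure (X × Fin K)} [SigmaFinite D] {H : Set (X → Fin K)}
    (hH : MeasurableClass D H) (t : ℝ) :
    NullMeasurableSet (deviationSet (ι := ι) H t) (Measure.pi fun _ => D) := by
  classical
  have : deviationSet (ι := ι) H t = ⋃ T : Finset (ι ⊕ ι), {S | T ∈ correctPatterns H S} ∩
      {_S | t ≤ ∑ i, ((if .inl i ∈ T then (1 : ℝ) else 0) - if .inr i ∈ T then 1 else 0)} := by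
    ext S
    simp [mem_deviationSet_iff]
  rw [this]
  exact .iUnion fun T => (hH.nullMeasurableSet T).inter (.const _)

/-- The permutation of a double sample that swaps the two copies of `i` whenever `σ i`. -/
def swapPerm {ι : Type*} (σ : ι → Bool) : Equiv.Perm (ι ⊕ ι) :=
  Function.Involutive.toPerm
    (Sum.elim (fun i => if σ i then .inr i else .inl i) fun i => if σ i then .inl i else .inr i)
    (by rintro (i | i) <;> by_cases h : σ i <;> simp [h])

theorem swapPerm_inl {ι : Type*} (σ : ι → Bool) (i : ι) :
    swapPerm σ (.inl i) = if σ i then .inr i else .inl i := rfl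

theorem swapPerm_inr {ι : Type*} (σ : ι → Bool) (i : ι) :
    swapPerm σ (.inr i) = if σ i then .inl i else .inr i := rfl

/-- For a fixed double sample, few swaps lead to a deviation of at least `t`. -/
theorem card_swaps_le {X ι : Type*} [Fintype ι] [DecidableEq ι] [Nonempty ι] {K : ℕ}
    {H : Set (X → Fin K)} {t : ℝ} (ht : 0 ≤ t) (S : ι ⊕ ι → X × Fin K)
    [DecidablePred fun σ : ι → Bool => S ∘ swapPerm σ ∈ deviationSet H t] :
    ((Finset.univ.filter fun σ : ι → Bool => S ∘ swapPerm σ ∈ deviationSet H t).card : ℝ) ≤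
      (correctPatterns H S).card *
        (2 ^ Fintype.card ι * Real.exp (-t ^ 2 / (2 * Fintype.card ι))) := by
  classical
  set u : Finset (ι ⊕ ι) → ι → ℝ := fun T i =>
    (if .inl i ∈ T then 1 else 0) - if .inr i ∈ T then 1 else 0 with hu
  have hu1 : ∀ T i, |u T i| ≤ 1 := by
    intro T i
    simp only [hu]
    split_ifs <;> simp
  have hsub : (Finset.univ.filter fun σ : ι → Bool => S ∘ swapPerm σ ∈ deviationSet H t) ⊆
      (correctPatterns H S).biUnion fun T =>
        Finset.univ.filter fun σ : ι → Bool => t ≤ ∑ i, if σ i then -u T i else u T i := by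
    intro σ hσ
    obtain ⟨h, hH, hh⟩ := (Finset.mem_filter.1 hσ).2
    refine Finset.mem_biUnion.2 ⟨Finset.univ.filter fun i => h (S i).1 = (S i).2,
      mem_correctPatterns.2 ⟨h, hH, by simp⟩, Finset.mem_filter.2 ⟨Finset.mem_univ _, ?_⟩⟩
    -- A swap at `i` flips the sign of `u T i`, where `T` is the pattern of `h` on the unswapped
    -- sample.
    refine hh.trans_eq (Finset.sum_congr rfl fun i _ => ?_)
    by_cases hi : σ i <;> simp [hu, swapPerm_inl, swapPerm_inr, hi]
  calc _ ≤ (((correctPatterns H S).biUnion fun T => Finset.univ.filter fun σ : ι → Bool =>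
          t ≤ ∑ i, if σ i then -u T i else u T i).card : ℝ) := by
        exact_mod_cast Finset.card_le_card hsub
    _ ≤ ∑ T ∈ correctPatterns H S, ((Finset.univ.filter fun σ : ι → Bool =>
          t ≤ ∑ i, if σ i then -u T i else u T i).card : ℝ) := by
        exact_mod_cast Finset.card_biUnion_le
    _ ≤ ∑ _T ∈ correctPatterns H S, 2 ^ Fintype.card ι *
          Real.exp (-t ^ 2 / (2 * Fintype.card ι)) :=
        Finset.sum_le_sum fun T _ => card_signs_le (u T) (hu1 T) ht
    _ = _ := by rw [Finset.sum_const, nsmul_eq_mul]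

/-- Each swap preserves the law, so the measure is the integral of the fraction of bad swaps, which
`card_swaps_le` bounds pointwise. -/
theorem measure_deviationSet_le {X ι : Type*} [MeasurableSpace X] [Fintype ι] [Nonempty ι] {K : ℕ}
    {D : Measure (X × Fin K)} [IsProbabilityMeasure D] {H : Set (X → Fin K)}
    (hH : MeasurableClass D H) {t : ℝ} (ht : 0 ≤ t) {N : ℝ}
    (hN : ∀ S : ι ⊕ ι → X × Fin K, ((correctPatterns H S).card : ℝ) ≤ N) :
    (Measure.pi fun _ => D) (deviationSet (ι := ι) H t) ≤
      ENNReal.ofReal (N * Real.exp (-t ^ 2 / (2 * Fintype.card ι))) := by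
  classical
  set μ : Measure (ι ⊕ ι → X × Fin K) := Measure.pi fun _ => D
  set B := deviationSet (X := X) (ι := ι) H t
  have hB : NullMeasurableSet B μ := hH.nullMeasurableSet_deviationSet t
  have hmp : ∀ σ : ι → Bool, MeasurePreserving (fun S => S ∘ swapPerm σ) μ μ :=
    fun σ => measurePreserving_comp_equiv D _
  have hBσ : ∀ σ : ι → Bool, NullMeasurableSet ((fun S => S ∘ swapPerm σ) ⁻¹' B) μ :=
    fun σ => hB.preimage (hmp σ).quasiMeasurePreserving
  have hsum : (2 ^ Fintype.card ι : ENNReal) * μ B =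
      ∫⁻ S, ∑ σ : ι → Bool, ((fun S => S ∘ swapPerm σ) ⁻¹' B).indicator (fun _ => (1 : ENNReal)) S ∂μ := by
    rw [lintegral_finsetSum' _ fun σ _ => (aemeasurable_indicator_const_iff 1).2 (hBσ σ)]
    simp_rw [lintegral_indicator_const₀ (hBσ _), (hmp _).measure_preimage hB]
    simp
  have hpt : ∀ S, ∑ σ : ι → Bool, ((fun S => S ∘ swapPerm σ) ⁻¹' B).indicator (fun _ => (1 : ENNReal)) S ≤
      2 ^ Fintype.card ι * ENNReal.ofReal (N * Real.exp (-t ^ 2 / (2 * Fintype.card ι))) := by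
    intro S
    have h1 : ∑ σ : ι → Bool, ((fun S => S ∘ swapPerm σ) ⁻¹' B).indicator (fun _ => (1 : ENNReal)) S =
        ENNReal.ofReal
          ((Finset.univ.filter fun σ : ι → Bool => S ∘ swapPerm σ ∈ B).card : ℝ) := by
      simp [Set.indicator_apply]
    have h2 : (2 ^ Fintype.card ι : ENNReal) = ENNReal.ofReal (2 ^ Fintype.card ι) := by
      rw [ENNReal.ofReal_pow zero_le_two, ENNReal.ofReal_ofNat]
    rw [h1, h2, ← ENNReal.ofReal_mul (by positivity)]
    refine ENNReal.ofReal_le_ofReal ((card_swaps_le ht S).trans ?_)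
    rw [mul_left_comm]
    have := hN S
    gcongr
  have hle : (2 ^ Fintype.card ι : ENNReal) * μ B ≤ 2 ^ Fintype.card ι *
      ENNReal.ofReal (N * Real.exp (-t ^ 2 / (2 * Fintype.card ι))) := by
    rw [hsum]
    exact (lintegral_mono hpt).trans (by simp)
  exact (ENNReal.mul_le_mul_iff_right (by simp) (by simp)).1 hle

/-! ### Comparison with a ghost sample. -/

/-- Hoeffding's inequality for the number of correct predictions of a fixed classifier. -/
theorem measureReal_accuracy_deviation_le {X : Type*} [MeasurableSpace X] {K m : ℕ}
    (D : Measure (X × Fin K)) [IsProbabilityMeasure D] {h : X → Fin K} (hh : Measurable h)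
    {t : ℝ} (ht : 0 ≤ t) :
    (Measure.pi fun _ : Fin m => D).real
      {S | t ≤ ∑ i, ((if h (S i).1 = (S i).2 then (1 : ℝ) else 0) - accuracy D h)} ≤
      Real.exp (-(2 * t ^ 2 / m)) := by
  set c : X × Fin K → ℝ := fun z => if h z.1 = z.2 then 1 else 0 with hc
  have hset : MeasurableSet {z : X × Fin K | h z.1 = z.2} :=
    measurableSet_eq_fun (hh.comp measurable_fst) measurable_snd
  have hcm : Measurable c := Measurable.ite hset measurable_const measurable_const
  have hint : ∫ z, c z ∂D = accuracy D h := by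
    have : c = {z : X × Fin K | h z.1 = z.2}.indicator 1 := by
      ext z
      simp [hc, Set.indicator_apply]
    rw [this, integral_indicator_one hset, accuracy]
  have hsub : ∀ i ∈ (Finset.univ : Finset (Fin m)), ProbabilityTheory.HasSubgaussianMGF
      (fun S : Fin m → X × Fin K => c (S i) - accuracy D h) ((‖(1 : ℝ) - 0‖₊ / 2) ^ 2)
      (Measure.pi fun _ : Fin m => D) := by
    intro i _
    have hmp := measurePreserving_eval (fun _ : Fin m => D) i
    have hX := ProbabilityTheory.hasSubgaussianMGF_of_mem_Icc
      (μ := Measure.pi fun _ : Fin m => D) (X := fun S => c (S i)) (a := 0) (b := 1)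
      (hcm.comp (measurable_pi_apply i)).aemeasurable
      (Filter.Eventually.of_forall fun S => by
        simp only [hc]
        split_ifs <;> simp)
    have hi : ∫ S : Fin m → X × Fin K, c (S i) ∂(Measure.pi fun _ : Fin m => D) =
        accuracy D h := by
      have hmap := integral_map (μ := Measure.pi fun _ : Fin m => D)
        hmp.measurable.aemeasurable (f := c) hcm.aestronglyMeasurable
      rw [hmp.map_eq, hint] at hmap
      exact hmap.symm
    rwa [hi] at hX
  have hind : ProbabilityTheory.iIndepFun
      (fun i (S : Fin m → X × Fin K) => c (S i) - accuracy D h)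
      (Measure.pi fun _ : Fin m => D) :=
    ProbabilityTheory.iIndepFun_pi (X := fun _ z => c z - accuracy D h)
      fun _ => (hcm.sub_const _).aemeasurable
  refine (ProbabilityTheory.HasSubgaussianMGF.measure_sum_ge_le_of_iIndepFun
    hind hsub ht).trans_eq ?_
  congr 1
  simp only [sub_zero, nnnorm_one, Finset.sum_const, Finset.card_univ, Fintype.card_fin]
  push_cast
  rcases Nat.eq_zero_or_pos m with rfl | hm
  · simp
  · have : (m : ℝ) ≠ 0 := by positivity
    field_simp
    ring

/-- Symmetrization by a ghost sample. -/
theorem measure_exists_deviation_le {X : Type*} [MeasurableSpace X] {K m : ℕ}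
    {D : Measure (X × Fin K)} [IsProbabilityMeasure D] {H : Set (X → Fin K)}
    (hmeas : ∀ h ∈ H, Measurable h) (hH : MeasurableClass D H) {t : ℝ} (ht : 0 ≤ t)
    (htm : Real.exp (-(2 * t ^ 2 / m)) ≤ 1 / 2) :
    (Measure.pi fun _ : Fin m => D)
      {S | ∃ h ∈ H, 2 * t < ∑ i, ((if h (S i).1 = (S i).2 then (1 : ℝ) else 0) - accuracy D h)} ≤
      2 * (Measure.pi fun _ => D) (deviationSet (ι := Fin m) H t) := by
  set μ : Measure (Fin m → X × Fin K) := Measure.pi fun _ => D with hμ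
  have hmp := measurePreserving_sumPiEquivProdPi_symm
    (X := fun _ : Fin m ⊕ Fin m => X × Fin K) (fun _ => D)
  set B := (MeasurableEquiv.sumPiEquivProdPi fun _ : Fin m ⊕ Fin m => X × Fin K).symm ⁻¹'
    deviationSet H t with hB
  have hBμ : (μ.prod μ) B = (Measure.pi fun _ => D) (deviationSet (ι := Fin m) H t) :=
    hmp.measure_preimage (hH.nullMeasurableSet_deviationSet t)
  -- `B` is only null-measurable; its measurable hull has the same measure and measurable sections.
  set M := toMeasurable (μ.prod μ) B with hM
  have hMm : MeasurableSet M := measurableSet_toMeasurable _ _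
  have hhalf : ∀ S ∈ {S : Fin m → X × Fin K | ∃ h ∈ H,
      2 * t < ∑ i, ((if h (S i).1 = (S i).2 then (1 : ℝ) else 0) - accuracy D h)},
      1 ≤ 2 * μ (Prod.mk S ⁻¹' M) := by
    rintro S ⟨h, hhH, hS⟩
    set E := {S : Fin m → X × Fin K |
      t ≤ ∑ i, ((if h (S i).1 = (S i).2 then (1 : ℝ) else 0) - accuracy D h)} with hE
    have hEm : MeasurableSet E := by
      refine measurableSet_le measurable_const (Finset.measurable_sum _ fun i _ =>
        Measurable.sub_const (Measurable.ite ?_ measurable_const measurable_const) _)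
      exact measurableSet_eq_fun ((hmeas h hhH).comp (measurable_pi_apply i).fst)
        (measurable_pi_apply i).snd
    -- An excess above `2 * t` on `S` and below `t` on `S'` leaves a gap above `t`. Here `h` depends
    -- on `S` but is fixed as `S'` varies, so Hoeffding for a single classifier suffices.
    have hsub : Eᶜ ⊆ Prod.mk S ⁻¹' M := by
      intro S' hS'
      refine subset_toMeasurable _ _ ⟨h, hhH, ?_⟩
      have hS'' := not_le.1 (show ¬ t ≤ _ from hS')
      change t ≤ ∑ i, ((if h (S i).1 = (S i).2 then (1 : ℝ) else 0) -
        if h (S' i).1 = (S' i).2 then 1 else 0)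
      rw [Finset.sum_sub_distrib] at hS hS'' ⊢
      linarith
    have hc : 1 / 2 ≤ μ.real Eᶜ := by
      rw [probReal_compl_eq_one_sub hEm]
      have := (measureReal_accuracy_deviation_le (m := m) D (hmeas h hhH) ht).trans htm
      linarith
    have h1 : (1 : ENNReal) ≤ 2 * μ Eᶜ := by
      rw [← ENNReal.ofReal_one, ← ENNReal.ofReal_ofNat, ← ofReal_measureReal,
        ← ENNReal.ofReal_mul (by norm_num)]
      exact ENNReal.ofReal_le_ofReal (by linarith)
    exact h1.trans (mul_le_mul_right (measure_mono hsub) 2)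
  calc _ ≤ ∫⁻ S, 2 * μ (Prod.mk S ⁻¹' M) ∂μ :=
        meas_le_lintegral₀ ((measurable_measure_prodMk_left hMm).const_mul 2).aemeasurable hhalf
    _ = 2 * (μ.prod μ) M := by
        rw [lintegral_const_mul _ (measurable_measure_prodMk_left hMm), Measure.prod_apply hMm]
    _ = _ := by rw [hM, measure_toMeasurable, hBμ]

/-! ### Choice of constants and conclusion. -/

theorem theorem2 {X : Type*} [MeasurableSpace X] {K : ℕ}
    (Dn : Measure (X × Fin K)) [IsProbabilityMeasure Dn]
    (H : Set (X → Fin K)) (hmeas : ∀ h ∈ H, Measurable h) (hclass : MeasurableClass Dn H)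
    (d : ℕ) (hd : vcDim H = d)
    (m : ℕ) (hm : 0 < m) (hdm : d ≤ 2 * m)
    (δ : ℝ) (hδ : 0 < δ) :
    ∃ G : Set (Fin m → X × Fin K), MeasurableSet G ∧
      1 - δ ≤ (Measure.pi fun _ : Fin m => Dn).real G ∧
      ∀ S ∈ G, ∀ h ∈ H,
        accuracy Dn h - sampleAccuracy S h ≥
          -Real.sqrt (8 * ((d : ℝ) * (Real.log (2 * m / d) + 1) + Real.log (4 / δ)) / m) := by
  rcases le_or_gt 1 δ with hδ1 | hδ1
  · exact ⟨∅, .empty, by simpa using hδ1, fun S hS => hS.elim⟩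
  have hm0 : (0 : ℝ) < m := by exact_mod_cast hm
  have : Nonempty (Fin m) := ⟨⟨0, hm⟩⟩
  set L : ℝ := (d : ℝ) * (Real.log (2 * m / d) + 1) with hL
  have hL0 : 0 ≤ L := by
    rcases Nat.eq_zero_or_pos d with rfl | hd0
    · simp [hL]
    · have hd' : (0 : ℝ) < d := by exact_mod_cast hd0
      have : 0 ≤ Real.log (2 * m / d) :=
        Real.log_nonneg ((one_le_div hd').2 (by exact_mod_cast hdm))
      positivity
  have hlog : Real.log 4 ≤ Real.log (4 / δ) :=
    Real.log_le_log (by norm_num) (by rw [le_div_iff₀ hδ]; linarith)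
  have hlog4 : 0 ≤ Real.log 4 := Real.log_nonneg (by norm_num)
  set ε := Real.sqrt (8 * (L + Real.log (4 / δ)) / m) with hε
  have hε2 : ε ^ 2 = 8 * (L + Real.log (4 / δ)) / m :=
    Real.sq_sqrt (div_nonneg (by linarith) hm0.le)
  -- Symmetrization halves the total deviation `m * ε`.
  set t := m * ε / 2 with ht
  have ht0 : 0 ≤ t := by positivity
  have ht2 : t ^ 2 = m * (2 * (L + Real.log (4 / δ))) := by
    rw [ht, div_pow, mul_pow, hε2]
    field_simp
    ring
  have htm : Real.exp (-(2 * t ^ 2 / m)) ≤ 1 / 2 := by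
    have h1 : -(2 * t ^ 2 / m) ≤ Real.log (1 / 2) := by
      rw [ht2, one_div, Real.log_inv]
      have h2 : Real.log 2 ≤ Real.log 4 := Real.log_le_log (by norm_num) (by norm_num)
      have h3 : 2 * (m * (2 * (L + Real.log (4 / δ)))) / m = 4 * (L + Real.log (4 / δ)) := by
        field_simp
        norm_num
      rw [h3]
      linarith
    exact (Real.exp_le_exp.2 h1).trans_eq (Real.exp_log (by norm_num))
  have hN : ∀ S : Fin m ⊕ Fin m → X × Fin K, ((correctPatterns H S).card : ℝ) ≤ Real.exp L := by
    intro S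
    refine (card_correctPatterns_le hd (by simp; omega) S).trans_eq ?_
    rw [hL, Fintype.card_sum, Fintype.card_fin, Nat.cast_add, ← two_mul]
  have hbad := (measure_exists_deviation_le hmeas hclass ht0 htm).trans
    (mul_le_mul_right (measure_deviationSet_le hclass ht0 hN) 2)
  -- Since `t ^ 2 / (2 * m) = L + log (4 / δ)`, the pattern count cancels. With the factor 2 from
  -- symmetrization the failure probability is at most `δ / 2`.
  have hval : Real.exp L * Real.exp (-t ^ 2 / (2 * (Fintype.card (Fin m) : ℕ))) = δ / 4 := by
    have : L + -t ^ 2 / (2 * m) = -Real.log (4 / δ) := by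
      rw [ht2]
      field_simp
      ring
    rw [Fintype.card_fin, ← Real.exp_add, this, ← Real.log_inv, Real.exp_log (by positivity),
      inv_div]
  rw [hval] at hbad
  set A := {S : Fin m → X × Fin K | ∃ h ∈ H,
    2 * t < ∑ i, ((if h (S i).1 = (S i).2 then (1 : ℝ) else 0) - accuracy Dn h)} with hA
  -- `A` need not be measurable, so its measurable hull is removed.
  refine ⟨(toMeasurable (Measure.pi fun _ => Dn) A)ᶜ, (measurableSet_toMeasurable _ _).compl,
    ?_, fun S hS h hh => ?_⟩
  · rw [probReal_compl_eq_one_sub (measurableSet_toMeasurable _ _)]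
    have : (Measure.pi fun _ : Fin m => Dn).real (toMeasurable (Measure.pi fun _ => Dn) A) ≤
        2 * (δ / 4) := by
      refine ENNReal.toReal_le_of_le_ofReal (by positivity) ?_
      rwa [measure_toMeasurable, ENNReal.ofReal_mul zero_le_two, ENNReal.ofReal_ofNat]
    linarith
  · have hSA : S ∉ A := fun h => hS (subset_toMeasurable _ _ h)
    have h1 := not_lt.1 fun hlt => hSA ⟨h, hh, hlt⟩
    rw [Finset.sum_sub_distrib, Finset.sum_const, Finset.card_univ, Fintype.card_fin,
      nsmul_eq_mul, ht] at h1
    have h2 : m * sampleAccuracy S h = ∑ i, if h (S i).1 = (S i).2 then (1 : ℝ) else 0 := by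
      rw [sampleAccuracy]
      field_simp
    have h3 : m * (sampleAccuracy S h - accuracy Dn h) ≤ m * ε := by
      rw [mul_sub, h2]
      linarith
    have := le_of_mul_le_mul_left h3 hm0
    linarith
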